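/- Let $K$ be a field and let $A=\bigoplus_{i\ge 0}A_i$ be a finite dimensional non-negatively graded $K$-algebra with Jacobson radical $J_A$ (a homogeneous ideal). For a $\mathbb{Z}$-graded right $A$-module $X$ and $n\in\mathbb{Z}$ let $X(n)$ denote the shift $X(n)_i=X_{i+n}$, and let $\operatorname{Ext}^n_A(-,-)_0$ denote the Ext groups in the abelian category of $\mathbb{Z}$-graded right $A$-modules with degree-preserving homomorphisms. Assume that $A$ is graded $1$-Iwanaga–Gorenstein, i.e. the injective dimensions of $A_A$ and ${}_AA$ in the categories of graded right, respectively left, $A$-modules are at most $1$. Put \[ g(A):=\sup\{\, i\in\mathbb{Z} \mid \operatorname{Ext}^n_A\big((A/J_A)(i),A\big)_0\neq 0 \text{ for some } n\ge 0 \,\}\in\mathbb{Z}\cup\{\pm\infty\}, \] and $A_{>0}:=\bigoplus_{i>0}A_i$, regarded as an $A_0$-$A_0$-bimodule. Then: (1) If every homomorphism of left $A_0$-modules $A_{>0}\to A_0$ is zero (that is, $\operatorname{Hom}_{A_0^{\mathrm{op}}}(A_{>0},A_0)=0$), then $g(A)\le 0$. (2) If $A_0$ has finite global dimension and every homomorphism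 of right $A_0$-modules $A_{>0}\to A_0$ is zero (that is, $\operatorname{Hom}_{A_0}(A_{>0},A_0)=0$), then $g(A)\le 0$. -/

import Mathlib

open CategoryTheory CategoryTheory.Limits

universe u v

namespace GradedIG

section Decomp

variable {ι M σ : Type*} [DecidableEq ι] [AddCommGroup M] [SetLike σ M] [AddSubgroupClass σ M]

/-- A decomposition into pieces `gr i` obtained from a family of additive projections. -/
@[reducible] noncomputable def decompositionOfProj (gr : ι → σ) (p : ι → M →+ M)
    (hmem : ∀ i x, p i x ∈ gr i) (hsame : ∀ i, ∀ x ∈ gr i, p i x = x)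
    (hne : ∀ i j, i ≠ j → ∀ x ∈ gr i, p j x = 0)
    (hsum : ∀ x, ∃ s : Finset ι, ∑ i ∈ s, p i x = x) : DirectSum.Decomposition gr :=
  DirectSum.IsInternal.chooseDecomposition gr (by
    classical
    have key : ∀ (d : DirectSum ι fun i => gr i) (j : ι),
        p j (DirectSum.coeAddMonoidHom gr d) = d j := by
      intro d j
      induction d using DirectSum.induction_on with
      | zero => simp
      | of i x =>
        rw [DirectSum.coeAddMonoidHom_of]
        by_cases h : i = j
        · subst h
          rw [hsame _ _ x.2, DirectSum.of_eq_same]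
        · rw [hne i j h _ x.2, DirectSum.of_eq_of_ne _ _ _ (Ne.symm h)]
          rfl
      | add x y hx hy =>
        rw [map_add, map_add, hx, hy, DirectSum.add_apply]
        rfl
    constructor
    · intro d e h
      refine DFinsupp.ext fun j => Subtype.ext ?_
      rw [← key d j, ← key e j, h]
    · intro x
      obtain ⟨s, hs⟩ := hsum x
      refine ⟨∑ i ∈ s, DirectSum.of (fun i => gr i) i ⟨p i x, hmem i x⟩, ?_⟩
      rw [map_sum]
      simp only [DirectSum.coeAddMonoidHom_of]
      exact hs)

/-- The `i`-th homogeneous component, as an additive endomorphism. -/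
def proj (gr : ι → σ) [DirectSum.Decomposition gr] (i : ι) : M →+ M where
  toFun x := (DirectSum.decompose gr x i : M)
  map_zero' := by simp
  map_add' x y := by simp

variable (gr : ι → σ) [DirectSum.Decomposition gr]

lemma proj_mem (i : ι) (x : M) : proj gr i x ∈ gr i := (DirectSum.decompose gr x i).2

lemma proj_same (i : ι) (x : M) (hx : x ∈ gr i) : proj gr i x = x :=
  DirectSum.decompose_of_mem_same gr hx

lemma proj_ne (i j : ι) (h : i ≠ j) (x : M) (hx : x ∈ gr i) : proj gr j x = 0 :=
  DirectSum.decompose_of_mem_ne gr hx h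

lemma exists_sum_proj (x : M) : ∃ s : Finset ι, ∑ i ∈ s, proj gr i x = x := by
  classical
  exact ⟨_, DirectSum.sum_support_decompose gr x⟩

end Decomp

section GrMod

variable {K : Type v} [Field K] {R : Type u} [Ring R] [Algebra K R]

/-- A `ℤ`-graded left module over a ring `R` graded by `ℛ i`, `i ∈ ℕ`. Right graded `A`-modules
are the graded left modules over `Aᵐᵒᵖ` with the opposite grading, see `opGrading`. -/
structure GrMod (ℛ : ℕ → Submodule K R) where
  carrier : Type u
  [addCommGroup : AddCommGroup carrier]
  [module : Module R carrier]
  gr : ℤ → AddSubgroup carrier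
  [decomposition : DirectSum.Decomposition gr]
  smul_mem : ∀ (i : ℕ) (j : ℤ) (r : R) (x : carrier), r ∈ ℛ i → x ∈ gr j → r • x ∈ gr (i + j)

attribute [instance] GrMod.addCommGroup GrMod.module GrMod.decomposition

namespace GrMod

variable {ℛ : ℕ → Submodule K R}

instance : CoeSort (GrMod ℛ) (Type u) := ⟨GrMod.carrier⟩

/-- Morphisms of graded modules: `R`-linear maps that preserve degrees. -/
@[ext]
structure Hom (X Y : GrMod ℛ) where
  lin : X →ₗ[R] Y
  map_mem : ∀ (i : ℤ) (x : X), x ∈ X.gr i → lin x ∈ Y.gr i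

/-- The category of `ℤ`-graded modules with degree-preserving linear maps. -/
instance : Category (GrMod ℛ) where
  Hom X Y := Hom X Y
  id X := ⟨LinearMap.id, fun _ _ h => h⟩
  comp f g := ⟨g.lin.comp f.lin, fun i x h => g.map_mem i _ (f.map_mem i x h)⟩

variable {X Y Z : GrMod ℛ}

@[ext]
lemma hom_ext {f g : X ⟶ Y} (h : ∀ x, f.lin x = g.lin x) : f = g :=
  Hom.ext (LinearMap.ext h)

@[simp] lemma id_lin (x : X) : Hom.lin (𝟙 X) x = x := rfl

@[simp] lemma comp_lin (f : X ⟶ Y) (g : Y ⟶ Z) (x : X) : (f ≫ g).lin x = g.lin (f.lin x) := rfl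

instance : Zero (X ⟶ Y) := ⟨⟨0, fun i _ _ => (Y.gr i).zero_mem⟩⟩

instance : Add (X ⟶ Y) :=
  ⟨fun f g => ⟨f.lin + g.lin, fun i x h => (Y.gr i).add_mem (f.map_mem i x h) (g.map_mem i x h)⟩⟩

instance : Neg (X ⟶ Y) := ⟨fun f => ⟨-f.lin, fun i x h => (Y.gr i).neg_mem (f.map_mem i x h)⟩⟩

@[simp] lemma zero_lin (x : X) : (0 : X ⟶ Y).lin x = 0 := rfl

@[simp] lemma add_lin (f g : X ⟶ Y) (x : X) : (f + g).lin x = f.lin x + g.lin x := rfl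

@[simp] lemma neg_lin (f : X ⟶ Y) (x : X) : (-f).lin x = -f.lin x := rfl

instance : AddCommGroup (X ⟶ Y) where
  add_assoc f g h := by ext x; simp [add_assoc]
  zero_add f := by ext x; simp
  add_zero f := by ext x; simp
  add_comm f g := by ext x; simp [add_comm]
  neg_add_cancel f := by ext x; simp
  nsmul := nsmulRec
  zsmul := zsmulRec

instance : Preadditive (GrMod ℛ) where
  add_comp X Y Z f g h := by ext x; simp
  comp_add X Y Z f g h := by ext x; simp

lemma lin_proj (f : X ⟶ Y) (i : ℤ) (x : X) : f.lin (proj X.gr i x) = proj Y.gr i (f.lin x) := by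
  obtain ⟨s, hs⟩ := exists_sum_proj X.gr x
  have h : ∀ j, proj Y.gr i (f.lin (proj X.gr j x)) =
      if j = i then f.lin (proj X.gr i x) else 0 := by
    intro j
    split_ifs with hj
    · subst hj
      exact proj_same _ _ _ (f.map_mem _ _ (proj_mem _ _ _))
    · exact proj_ne _ j i hj _ (f.map_mem _ _ (proj_mem _ _ _))
  have h0 : i ∉ s → proj X.gr i x = 0 := by
    intro hi
    rw [← hs, map_sum]
    refine Finset.sum_eq_zero fun j hj => proj_ne _ j i ?_ _ (proj_mem _ _ _)
    rintro rfl
    exact hi hj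
  have h1 : proj Y.gr i (f.lin x) = if i ∈ s then f.lin (proj X.gr i x) else 0 := by
    conv_lhs => rw [← hs]
    rw [map_sum, map_sum, Finset.sum_congr rfl fun j _ => h j, Finset.sum_ite_eq']
  rw [h1]
  split_ifs with hi
  · rfl
  · rw [h0 hi, map_zero]

/-- The graded submodule on a homogeneous submodule. -/
noncomputable def sub (X : GrMod ℛ) (p : Submodule R X) (hp : ∀ i, ∀ x ∈ p, proj X.gr i x ∈ p) :
    GrMod ℛ where
  carrier := p
  gr i := (X.gr i).comap p.subtype.toAddMonoidHom
  decomposition := decompositionOfProj _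
    (fun i => ((proj X.gr i).comp p.subtype.toAddMonoidHom).codRestrict p.toAddSubgroup
      (fun x => hp i x x.2))
    (fun i x => proj_mem X.gr i (x : X))
    (fun i x hx => Subtype.ext (proj_same X.gr i _ hx))
    (fun i j h x hx => Subtype.ext (proj_ne X.gr i j h _ hx))
    (fun x => by
      obtain ⟨s, hs⟩ := exists_sum_proj X.gr (x : X)
      refine ⟨s, Subtype.ext ?_⟩
      rw [AddSubmonoidClass.coe_finsetSum]
      exact hs)
  smul_mem i j r x hr hx := X.smul_mem i j r x hr hx

/-- The graded quotient by a homogeneous submodule. -/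
noncomputable def quot (X : GrMod ℛ) (p : Submodule R X) (hp : ∀ i, ∀ x ∈ p, proj X.gr i x ∈ p) :
    GrMod ℛ where
  carrier := X ⧸ p
  gr i := (X.gr i).map p.mkQ.toAddMonoidHom
  decomposition := decompositionOfProj _
    (fun i => QuotientAddGroup.map p.toAddSubgroup p.toAddSubgroup (proj X.gr i)
      (fun x hx => hp i x hx))
    (by
      intro i x
      obtain ⟨x, rfl⟩ := p.mkQ_surjective x
      exact ⟨proj X.gr i x, proj_mem X.gr i x, rfl⟩)
    (by
      rintro i _ ⟨x, hx, rfl⟩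
      exact congrArg p.mkQ (proj_same X.gr i x hx))
    (by
      rintro i j h _ ⟨x, hx, rfl⟩
      exact (congrArg p.mkQ (proj_ne X.gr i j h x hx)).trans (map_zero _))
    (by
      intro x
      obtain ⟨x, rfl⟩ := p.mkQ_surjective x
      obtain ⟨s, hs⟩ := exists_sum_proj X.gr x
      refine ⟨s, ?_⟩
      have := congrArg p.mkQ hs
      rw [map_sum] at this
      exact this)
  smul_mem := by
    rintro i j r _ hr ⟨x, hx, rfl⟩
    exact ⟨r • x, X.smul_mem i j r x hr hx, map_smul p.mkQ r x⟩

/-- The direct sum of two graded modules. -/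
noncomputable def prod (X Y : GrMod ℛ) : GrMod ℛ where
  carrier := X × Y
  gr i := (X.gr i).prod (Y.gr i)
  decomposition := decompositionOfProj _
    (fun i => (proj X.gr i).prodMap (proj Y.gr i))
    (fun i x => ⟨proj_mem X.gr i x.1, proj_mem Y.gr i x.2⟩)
    (fun i x hx => Prod.ext (proj_same X.gr i _ hx.1) (proj_same Y.gr i _ hx.2))
    (fun i j h x hx => Prod.ext (proj_ne X.gr i j h _ hx.1) (proj_ne Y.gr i j h _ hx.2))
    (by
      intro x
      classical
      obtain ⟨s, hs⟩ := exists_sum_proj (fun i => (X.gr i)) x.1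
      obtain ⟨t, ht⟩ := exists_sum_proj (fun i => (Y.gr i)) x.2
      have aux : ∀ {W : GrMod ℛ} (w : W) (a b : Finset ℤ), a ⊆ b →
          ∑ i ∈ a, proj W.gr i w = w → ∑ i ∈ b, proj W.gr i w = w := by
        intro W w a b hab ha
        rw [← Finset.sum_subset hab, ha]
        intro i _ hi
        rw [← ha, map_sum]
        refine Finset.sum_eq_zero fun j hj => proj_ne _ j i ?_ _ (proj_mem _ _ _)
        rintro rfl
        exact hi hj
      refine ⟨s ∪ t, Prod.ext ?_ ?_⟩
      · rw [Prod.fst_sum]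
        exact aux x.1 s _ Finset.subset_union_left hs
      · rw [Prod.snd_sum]
        exact aux x.2 t _ Finset.subset_union_right ht)
  smul_mem i j r x hr hx := ⟨X.smul_mem i j r _ hr hx.1, Y.smul_mem i j r _ hr hx.2⟩

/-- The zero graded module. -/
noncomputable def zero (ℛ : ℕ → Submodule K R) : GrMod ℛ where
  carrier := PUnit
  gr _ := ⊤
  decomposition := decompositionOfProj _ (fun _ => 0) (fun _ _ => trivial) (fun _ _ _ => rfl)
    (fun _ _ _ _ _ => rfl) (fun _ => ⟨∅, rfl⟩)
  smul_mem _ _ _ _ _ _ := trivial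

instance : HasZeroObject (GrMod ℛ) :=
  ⟨zero ℛ, by
    rw [IsZero.iff_id_eq_zero]
    ext x
    rfl⟩

/-- The biproduct cone on the direct sum. -/
noncomputable def prodBicone (X Y : GrMod ℛ) : BinaryBicone X Y where
  pt := prod X Y
  fst := ⟨LinearMap.fst R X Y, fun _ _ h => h.1⟩
  snd := ⟨LinearMap.snd R X Y, fun _ _ h => h.2⟩
  inl := ⟨LinearMap.inl R X Y, fun i _ h => ⟨h, (Y.gr i).zero_mem⟩⟩
  inr := ⟨LinearMap.inr R X Y, fun i _ h => ⟨(X.gr i).zero_mem, h⟩⟩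
  inl_fst := rfl
  inl_snd := rfl
  inr_fst := rfl
  inr_snd := rfl

instance : HasBinaryBiproducts (GrMod ℛ) where
  has_binary_biproduct X Y := hasBinaryBiproduct_of_total (prodBicone X Y) (by
    refine hom_ext fun x => ?_
    exact Prod.ext (add_zero x.1) (zero_add x.2))

instance : HasFiniteProducts (GrMod ℛ) := hasFiniteProducts_of_has_binary_and_terminal

lemma ker_homogeneous (f : X ⟶ Y) (i : ℤ) (x : X) (hx : x ∈ f.lin.ker) :
    proj X.gr i x ∈ f.lin.ker := by
  rw [LinearMap.mem_ker] at hx ⊢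
  rw [lin_proj, hx, map_zero]

lemma range_homogeneous (f : X ⟶ Y) (i : ℤ) (y : Y) (hy : y ∈ f.lin.range) :
    proj Y.gr i y ∈ f.lin.range := by
  obtain ⟨x, rfl⟩ := hy
  exact ⟨proj X.gr i x, lin_proj f i x⟩

/-- The inclusion of a graded submodule. -/
noncomputable def subι (X : GrMod ℛ) (p : Submodule R X)
    (hp : ∀ i, ∀ x ∈ p, proj X.gr i x ∈ p) : X.sub p hp ⟶ X :=
  ⟨p.subtype, fun _ _ h => h⟩

/-- The projection to a graded quotient. -/
noncomputable def quotπ (X : GrMod ℛ) (p : Submodule R X)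
    (hp : ∀ i, ∀ x ∈ p, proj X.gr i x ∈ p) : X ⟶ X.quot p hp :=
  ⟨p.mkQ, fun _ x h => ⟨x, h, rfl⟩⟩

/-- A degree-preserving injective map is a kernel of every map with the right zero set. -/
noncomputable def isLimitOfInjective (i : X ⟶ Y) (g : Y ⟶ Z) (w : i ≫ g = 0)
    (hi : Function.Injective i.lin) (hex : ∀ y, g.lin y = 0 → ∃ x, i.lin x = y) :
    IsLimit (KernelFork.ofι i w) :=
  haveI : Mono i := ⟨fun a b hab => hom_ext fun z =>
    hi (congrArg (fun f => Hom.lin f z) hab)⟩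
  KernelFork.IsLimit.ofι' i w fun {W} k hk => by
    have hk' : ∀ y, g.lin (k.lin y) = 0 := fun y => congrArg (fun f => Hom.lin f y) hk
    have e : i.lin.range = g.lin.ker := by
      ext y
      constructor
      · rintro ⟨x, rfl⟩
        exact congrArg (fun f => Hom.lin f x) w
      · exact hex y
    let φ : W →ₗ[R] X := (LinearEquiv.ofInjective i.lin hi).symm.toLinearMap.comp
      (k.lin.codRestrict i.lin.range fun y => by rw [e]; exact hk' y)
    have hφ : ∀ y, i.lin (φ y) = k.lin y := fun y =>
      congrArg Subtype.val ((LinearEquiv.ofInjective i.lin hi).apply_symm_apply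
        ⟨k.lin y, by rw [e]; exact hk' y⟩)
    refine ⟨⟨φ, fun n y hy => ?_⟩, hom_ext hφ⟩
    have : φ y = proj X.gr n (φ y) := by
      apply hi
      rw [lin_proj, hφ]
      exact (proj_same _ _ _ (k.map_mem n y hy)).symm
    rw [this]
    exact proj_mem _ _ _

/-- A degree-preserving surjective map is a cokernel of every map onto its zero set. -/
noncomputable def isColimitOfSurjective (g : X ⟶ Y) (q : Y ⟶ Z) (w : g ≫ q = 0)
    (hq : Function.Surjective q.lin) (hex : ∀ y, q.lin y = 0 → ∃ x, g.lin x = y) :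
    IsColimit (CokernelCofork.ofπ q w) :=
  haveI : Epi q := ⟨fun a b hab => hom_ext fun z => by
    obtain ⟨y, rfl⟩ := hq z
    exact congrArg (fun f => Hom.lin f y) hab⟩
  CokernelCofork.IsColimit.ofπ' q w fun {W} k hk => by
    have hk' : ∀ x, k.lin (g.lin x) = 0 := fun y => congrArg (fun f => Hom.lin f y) hk
    have hle : q.lin.ker ≤ k.lin.ker := by
      intro y hy
      obtain ⟨x, rfl⟩ := hex y hy
      exact hk' x
    let φ : Z →ₗ[R] W := (q.lin.ker.liftQ k.lin hle).comp
      (q.lin.quotKerEquivOfSurjective hq).symm.toLinearMap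
    have hφ : ∀ y, φ (q.lin y) = k.lin y := by
      intro y
      have : (q.lin.quotKerEquivOfSurjective hq).symm (q.lin y) = q.lin.ker.mkQ y := by
        rw [LinearEquiv.symm_apply_eq]
        rfl
      change (q.lin.ker.liftQ k.lin hle) ((q.lin.quotKerEquivOfSurjective hq).symm (q.lin y)) = _
      rw [this]
      rfl
    refine ⟨⟨φ, fun n z hz => ?_⟩, hom_ext hφ⟩
    obtain ⟨y, rfl⟩ := hq z
    have : q.lin y = q.lin (proj Y.gr n y) := by
      rw [lin_proj]
      exact (proj_same _ _ _ hz).symm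
    rw [this, hφ]
    exact k.map_mem _ _ (proj_mem _ _ _)

/-- Graded modules form an abelian category, with kernels, cokernels and images computed on the
underlying modules. -/
noncomputable instance : Abelian (GrMod ℛ) :=
  Abelian.mk' fun X Y f => ⟨
    { kernelFork := KernelFork.ofι (X.subι f.lin.ker (ker_homogeneous f))
        (hom_ext fun x => x.2)
      isLimitKernelFork := isLimitOfInjective _ _ _ Subtype.val_injective
        fun y hy => ⟨⟨y, hy⟩, rfl⟩
      cokernelCofork := CokernelCofork.ofπ (Y.quotπ f.lin.range (range_homogeneous f))
        (hom_ext fun x => (Submodule.Quotient.mk_eq_zero _).2 ⟨x, rfl⟩)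
      isColimitCokernelCofork := isColimitOfSurjective _ _ _ (Submodule.mkQ_surjective _)
        fun _ hy => (Submodule.Quotient.mk_eq_zero _).1 hy
      image := Y.sub f.lin.range (range_homogeneous f)
      imageπ := ⟨f.lin.rangeRestrict, f.map_mem⟩
      ι_imageπ := hom_ext fun x => Subtype.ext x.2
      imageIsCokernel := isColimitOfSurjective _ _ _ f.lin.surjective_rangeRestrict
        fun y hy => ⟨⟨y, congrArg Subtype.val hy⟩, rfl⟩
      imageι := Y.subι f.lin.range (range_homogeneous f)
      imageι_π := hom_ext fun x => (Submodule.Quotient.mk_eq_zero _).2 x.2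
      imageIsKernel := isLimitOfInjective _ _ _ Subtype.val_injective
        fun y hy => ⟨⟨y, (Submodule.Quotient.mk_eq_zero _).1 hy⟩, rfl⟩
      fac := rfl }⟩

/-- The degree shift `X(n)`, with `X(n)_i = X_{i+n}`. -/
noncomputable def shift (X : GrMod ℛ) (n : ℤ) : GrMod ℛ where
  carrier := X
  gr i := X.gr (i + n)
  decomposition := decompositionOfProj _ (fun i => proj X.gr (i + n))
    (fun i x => proj_mem X.gr (i + n) x)
    (fun i x hx => proj_same X.gr (i + n) x hx)
    (fun i j h x hx => proj_ne X.gr (i + n) (j + n) (by simpa using h) x hx)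
    (fun x => by
      obtain ⟨s, hs⟩ := exists_sum_proj X.gr x
      refine ⟨s.map (Equiv.subRight n).toEmbedding, ?_⟩
      simpa using hs)
  smul_mem i j r x hr hx := by
    rw [add_assoc]
    exact X.smul_mem i (j + n) r x hr hx

end GrMod

section Regular

variable (ℛ : ℕ → Submodule K R)

/-- The grading of `R`, extended by zero to negative degrees. -/
def intGrading : ℤ → AddSubgroup R
  | Int.ofNat n => (ℛ n).toAddSubgroup
  | Int.negSucc _ => ⊥

/-- The projections belonging to `intGrading`. -/
def intProj [GradedAlgebra ℛ] : ℤ → R →+ R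
  | Int.ofNat n => proj ℛ n
  | Int.negSucc _ => 0

/-- The graded ring `R` as a graded left module over itself. -/
noncomputable def regular [GradedAlgebra ℛ] : GrMod ℛ where
  carrier := R
  gr := intGrading ℛ
  decomposition := decompositionOfProj _ (intProj ℛ)
    (by
      rintro (i | i) x
      · exact proj_mem ℛ i x
      · exact rfl)
    (by
      rintro (i | i) x hx
      · exact proj_same ℛ i x hx
      · exact (show x = 0 from hx).symm)
    (by
      rintro (i | i) (j | j) h x hx
      · exact proj_ne ℛ i j (fun e => h (congrArg _ e)) x hx
      · rfl
      · rw [show x = 0 from hx, map_zero]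
      · rfl)
    (by
      intro x
      obtain ⟨s, hs⟩ := exists_sum_proj ℛ x
      refine ⟨s.map Nat.castEmbedding, ?_⟩
      rw [Finset.sum_map]
      exact hs)
  smul_mem := by
    rintro i (j | j) r x hr hx
    · exact SetLike.mul_mem_graded (A := ℛ) hr hx
    · rw [show x = 0 from hx, smul_zero]
      exact AddSubgroup.zero_mem _

end Regular

section Radical

variable (ℛ : ℕ → Submodule K R) [GradedAlgebra ℛ]

lemma exists_bound [FiniteDimensional K R] : ∃ N : ℕ, ∀ n, N ≤ n → ℛ n = ⊥ := by
  have hfin : Set.Finite {n | ℛ n ≠ ⊥} :=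
    WellFoundedGT.finite_ne_bot_of_iSupIndep
      (DirectSum.Decomposition.isInternal ℛ).submodule_iSupIndep
  obtain ⟨N, hN⟩ := hfin.bddAbove
  refine ⟨N + 1, fun n hn => ?_⟩
  by_contra h
  have := hN (show n ∈ {n | ℛ n ≠ ⊥} from h)
  omega

lemma isNilpotent_of_component_zero [FiniteDimensional K R] (x : R) (hx : proj ℛ 0 x = 0) :
    IsNilpotent x := by
  classical
  have hmul : ∀ (n : ℕ) (y : R), (∀ k < n, proj ℛ k y = 0) →
      ∀ k < n + 1, proj ℛ k (y * x) = 0 := by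
    intro n y hy k hk
    obtain ⟨s, hs⟩ := exists_sum_proj ℛ y
    obtain ⟨t, ht⟩ := exists_sum_proj ℛ x
    rw [← hs, ← ht, Finset.sum_mul_sum, map_sum]
    refine Finset.sum_eq_zero fun i _ => ?_
    rw [map_sum]
    refine Finset.sum_eq_zero fun j _ => ?_
    by_cases hi : i < n
    · rw [hy i hi, zero_mul, map_zero]
    · rcases Nat.eq_zero_or_pos j with rfl | hj
      · rw [hx, mul_zero, map_zero]
      · exact proj_ne ℛ (i + j) k (by omega) _
          (SetLike.mul_mem_graded (A := ℛ) (proj_mem ℛ i y) (proj_mem ℛ j x))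
  have hpow : ∀ n : ℕ, ∀ k < n, proj ℛ k (x ^ n) = 0 := by
    intro n
    induction n with
    | zero => intro k hk; omega
    | succ n ih => rw [pow_succ]; exact hmul n _ ih
  obtain ⟨N, hN⟩ := exists_bound ℛ
  refine ⟨N, ?_⟩
  obtain ⟨s, hs⟩ := exists_sum_proj ℛ (x ^ N)
  rw [← hs]
  refine Finset.sum_eq_zero fun k _ => ?_
  by_cases hk : k < N
  · exact hpow N k hk
  · have := proj_mem ℛ k (x ^ N)
    rw [hN k (by omega)] at this
    exact this

lemma mem_jacobson_of_component_zero [FiniteDimensional K R] (x : R) (hx : proj ℛ 0 x = 0) :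
    x ∈ Ring.jacobson R := by
  rw [← Ideal.jacobson_bot, Ideal.mem_jacobson_iff]
  intro y
  have h0 : proj ℛ 0 (y * x) = 0 := by
    classical
    obtain ⟨s, hs⟩ := exists_sum_proj ℛ y
    obtain ⟨t, ht⟩ := exists_sum_proj ℛ x
    rw [← hs, ← ht, Finset.sum_mul_sum, map_sum]
    refine Finset.sum_eq_zero fun i _ => ?_
    rw [map_sum]
    refine Finset.sum_eq_zero fun j _ => ?_
    rcases Nat.eq_zero_or_pos j with rfl | hj
    · rw [hx, mul_zero, map_zero]
    · exact proj_ne ℛ (i + j) 0 (by omega) _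
        (SetLike.mul_mem_graded (A := ℛ) (proj_mem ℛ i y) (proj_mem ℛ j x))
  obtain ⟨u, hu⟩ := (isNilpotent_of_component_zero ℛ _ h0).isUnit_add_one
  refine ⟨(u⁻¹ : Rˣ), ?_⟩
  have h1 : (↑(u⁻¹) : R) * (y * x + 1) = 1 := by rw [← hu]; exact u.inv_mul
  rw [Ideal.mem_bot, mul_assoc, ← h1]
  noncomm_ring

lemma regular_proj (n : ℕ) (x : R) : proj (M := regular ℛ) (regular ℛ).gr n x = proj ℛ n x := by
  obtain ⟨s, hs⟩ := exists_sum_proj ℛ x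
  have hL : ∀ k : ℕ, proj (M := regular ℛ) (regular ℛ).gr n (proj ℛ k x : R) = proj ℛ n (proj ℛ k x) := by
    intro k
    have hk : (proj ℛ k x : R) ∈ (regular ℛ).gr k := proj_mem ℛ k x
    by_cases h : k = n
    · subst h
      exact (proj_same (M := regular ℛ) _ _ _ hk).trans (proj_same ℛ k _ (proj_mem ℛ k _)).symm
    · exact (proj_ne (M := regular ℛ) _ (k : ℤ) n (by exact_mod_cast h) _ hk).trans
        (proj_ne ℛ k n h _ (proj_mem ℛ k _)).symm
  have h1 : proj (M := regular ℛ) (regular ℛ).gr n (∑ k ∈ s, proj ℛ k x : R) =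
      proj ℛ n (∑ k ∈ s, proj ℛ k x) := by
    rw [map_sum (proj ℛ n)]
    exact (map_sum (proj (M := regular ℛ) (regular ℛ).gr n) _ _).trans (Finset.sum_congr rfl fun k _ => hL k)
  rw [hs] at h1
  exact h1

lemma proj_zero_mem_jacobson [FiniteDimensional K R] (x : R) (hx : x ∈ Ring.jacobson R) :
    proj ℛ 0 x ∈ Ring.jacobson R := by
  have h := mem_jacobson_of_component_zero ℛ (x - proj ℛ 0 x)
    (by rw [map_sub, proj_same ℛ 0 _ (proj_mem ℛ 0 x), sub_self])
  have h' := Submodule.sub_mem _ hx h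
  rwa [sub_sub_cancel] at h'

/-- The Jacobson radical of a finite-dimensional `ℕ`-graded algebra is homogeneous. -/
lemma jacobson_homogeneous [FiniteDimensional K R] (i : ℤ) (x : regular ℛ)
    (hx : x ∈ (Ring.jacobson R : Submodule R R)) :
    proj (regular ℛ).gr i x ∈ (Ring.jacobson R : Submodule R R) := by
  have hcoe : ∀ n : ℕ, proj (regular ℛ).gr n x = proj ℛ n x := fun n => regular_proj ℛ n x
  rcases i with (_ | n) | n
  · have e := hcoe 0
    change proj (regular ℛ).gr (0 : ℕ) x ∈ _
    rw [e]
    exact proj_zero_mem_jacobson ℛ x hx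
  · have e := hcoe (n + 1)
    change proj (regular ℛ).gr (n + 1 : ℕ) x ∈ _
    rw [e]
    exact mem_jacobson_of_component_zero ℛ _
      (proj_ne ℛ (n + 1) 0 (by omega) _ (proj_mem ℛ (n + 1) _))
  · have hm := proj_mem (regular ℛ).gr (Int.negSucc n) x
    rw [show proj (regular ℛ).gr (Int.negSucc n) x = 0 from hm]
    exact Submodule.zero_mem _

/-- The graded module `R/J` where `J` is the Jacobson radical of `R`. -/
noncomputable def top [FiniteDimensional K R] : GrMod ℛ :=
  (regular ℛ).quot (Ring.jacobson R : Submodule R R) (jacobson_homogeneous ℛ)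

/-- `g(M) = sup { i ∈ ℤ | Ext^n(R/J (i), M)_0 ≠ 0 for some n ≥ 0 }`, where `Ext(-, -)_0` is taken
in the category of graded modules; the supremum is taken in `ℤ ∪ {-∞, ∞}`. -/
noncomputable def gInvariant [FiniteDimensional K R] (M : GrMod ℛ) : WithBot (WithTop ℤ) :=
  letI := HasExt.standard (GrMod ℛ)
  sSup {g | ∃ i : ℤ, g = ((i : WithTop ℤ) : WithBot (WithTop ℤ)) ∧
    ∃ n : ℕ, Nontrivial (Abelian.Ext.{u + 1} ((top ℛ).shift i) M n)}

end Radical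

section GradeZero

variable (ℛ : ℕ → Submodule K R) [GradedAlgebra ℛ]

/-- `R` as a left module over its degree zero part. -/
instance gradeZeroModule : Module (ℛ 0) R :=
  Module.compHom R (SetLike.GradeZero.subring ℛ).subtype

/-- The left `R_0`-module `R_{>0} = ⨁_{i > 0} R_i` (elements with vanishing degree zero part). -/
def positivePart : Submodule (ℛ 0) R where
  carrier := {x | (DirectSum.decompose ℛ x 0 : R) = 0}
  zero_mem' := by simp
  add_mem' {x y} hx hy := by
    change (DirectSum.decompose ℛ (x + y) 0 : R) = 0
    rw [DirectSum.decompose_add, DirectSum.add_apply, Submodule.coe_add, hx, hy, add_zero]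
  smul_mem' a x hx := by
    change (DirectSum.decompose ℛ ((a : R) * x) 0 : R) = 0
    rw [DirectSum.coe_decompose_mul_of_left_mem_zero ℛ a.2, hx, mul_zero]

noncomputable instance positivePartModule : Module (ℛ 0) (positivePart ℛ) :=
  (positivePart ℛ).module

noncomputable instance positivePartSMul : SMul (ℛ 0) (positivePart ℛ) :=
  (positivePartModule ℛ).toSMul

end GradeZero

end GrMod

section Algebra

variable {K : Type v} [Field K] {A : Type u} [Ring A] [Algebra K A]

/-- The opposite grading on `Aᵐᵒᵖ`: `(Aᵐᵒᵖ)_i = (A_i)ᵐᵒᵖ`. -/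
def opGrading (𝒜 : ℕ → Submodule K A) (i : ℕ) : Submodule K Aᵐᵒᵖ :=
  (𝒜 i).comap (MulOpposite.opLinearEquiv K).symm.toLinearMap

noncomputable instance (𝒜 : ℕ → Submodule K A) [GradedAlgebra 𝒜] :
    GradedAlgebra (opGrading 𝒜) where
  one_mem := SetLike.one_mem_graded 𝒜
  mul_mem i j x y hx hy := by
    rw [add_comm]
    exact SetLike.mul_mem_graded (A := 𝒜) hy hx
  toDecomposition := decompositionOfProj _
    (fun i => ((MulOpposite.opAddEquiv : A ≃+ Aᵐᵒᵖ).toAddMonoidHom.comp (proj 𝒜 i)).comp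
      (MulOpposite.opAddEquiv : A ≃+ Aᵐᵒᵖ).symm.toAddMonoidHom)
    (fun i x => proj_mem 𝒜 i x.unop)
    (fun i x hx => MulOpposite.unop_injective (proj_same 𝒜 i x.unop hx))
    (fun i j h x hx => MulOpposite.unop_injective (proj_ne 𝒜 i j h x.unop hx))
    (fun x => by
      obtain ⟨s, hs⟩ := exists_sum_proj 𝒜 x.unop
      refine ⟨s, ?_⟩
      have h := congrArg (MulOpposite.opAddEquiv : A ≃+ Aᵐᵒᵖ) hs
      rw [map_sum] at h
      exact h)

/-- `A` is graded `d`-Iwanaga-Gorenstein: the injective dimensions of `A_A` and `_AA` in the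
categories of graded right, respectively left, `A`-modules are at most `d`. -/
def IsGradedIG (d : ℕ) (𝒜 : ℕ → Submodule K A) [GradedAlgebra 𝒜] : Prop :=
  HasInjectiveDimensionLE (regular (opGrading 𝒜)) d ∧ HasInjectiveDimensionLE (regular 𝒜) d

/-- The invariant `g(A) = g(A_A)`, computed in the category of graded right `A`-modules. -/
noncomputable def g (𝒜 : ℕ → Submodule K A) [GradedAlgebra 𝒜] [FiniteDimensional K A] :
    WithBot (WithTop ℤ) :=
  gInvariant (opGrading 𝒜) (regular (opGrading 𝒜))

/-- Finite global dimension, with right modules. -/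
def HasFiniteGlobalDimension (Λ : Type u) [Ring Λ] : Prop :=
  ∃ n : ℕ, ∀ M : ModuleCat.{u} Λᵐᵒᵖ, HasProjectiveDimensionLE M n

/-- `Hom_{(A_0)^op}(A_{>0}, A_0)`: homomorphisms of left `A_0`-modules. -/
abbrev LeftHom (𝒜 : ℕ → Submodule K A) [GradedAlgebra 𝒜] : Type u :=
  positivePart 𝒜 →ₗ[𝒜 0] 𝒜 0

/-- `Hom_{A_0}(A_{>0}, A_0)`: homomorphisms of right `A_0`-modules, i.e. of left modules over the
degree zero part of `Aᵐᵒᵖ`. -/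
abbrev RightHom (𝒜 : ℕ → Submodule K A) [GradedAlgebra 𝒜] : Type u :=
  positivePart (opGrading 𝒜) →ₗ[opGrading 𝒜 0] opGrading 𝒜 0

end Algebra

end GradedIG

/-!
Right `A`-modules are left modules over `R = Aᵐᵒᵖ`, so everything is done for graded left modules
over a finite-dimensional graded algebra `R`.

The regular module embeds into the injective graded module `Hom_K(R, R)`; the cokernel `C`, the
first cosyzygy, consists of the linear endomorphisms `c` of `R` with `c 1 = 0`, on which `R` acts by
`(rc)(x) = c(xr) - x c(r)`. Let `i > 0` and let `J` be the radical of `R`. Homomorphisms from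
`(R/J)(i)` to `R` vanish for degree reasons, the higher groups `Ext` vanish by the bound on the
injective dimension, and `Ext¹` is a quotient of `Hom((R/J)(i), C)`. Therefore `g ≤ 0` as soon as
no nonzero element of `C` of negative degree is annihilated by `R_{>0}`
(`NoNegativeSocle.gInvariant_le_zero`).

Injective dimension at most one makes `C` injective, hence a retract of `Hom_K(R, C)`. Write `DR`
for the dual of `R`. For `y` in `C` of degree `-i`, the maps `x ↦ ψ(x)y` with `ψ` in `DR` are sent by
the retraction to the values of a homomorphism `G : DR → C` of degree `-i`, and every `y` in `C` of
degree `-i` that is annihilated by `R_{>0}` is a sum of values of such homomorphisms at functionals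
supported on `R_0`. So it suffices to show that these values vanish
(`noNegativeSocle_of_cocycles_vanish`). Spelled out, `G` is a cocycle:
`G(ψ)(xr) = G(rψ)(x) + x G(ψ)(r)`.

If `Hom(R_{>0}, R_0) = 0` for right `R_0`-modules, the values vanish because `G` gives maps
`D(R_0) → D(R_{>0})` of left `R_0`-modules, which are dual to maps `R_{>0} → R_0` of right
`R_0`-modules (`IsCocycle.apply_eq_zero`). With `R = Aᵐᵒᵖ` this is the first assertion.

For the second assertion the same argument, applied to `R = A` and the injective dimension of `A` as
a left module, shows that the cosyzygy of the left module `A` has no element of negative degree that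
is annihilated by `A_{>0}`. The duality over `K` exchanges extensions of `DA(i)` by `A` for right
and for left modules: a cocycle for `Aᵐᵒᵖ` is a trilinear form `φ(G(ψ)(a))`, and read in the
other order it is a homomorphism of left modules from `DA` to the cosyzygy of `A`, of negative
degree. Such a homomorphism is zero by induction on the degree, so all cocycles for `Aᵐᵒᵖ`
vanish (`NoNegativeSocle.cocycle_op_eq_zero`).
-/

namespace GradedIG

/-! ### Degrees of linear maps and functionals -/

section Degrees

variable {K : Type v} [Field K] {R : Type u} [Ring R] [Algebra K R]
variable (ℛ : ℕ → Submodule K R)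

/-- The linear endomorphism `f` of `R` maps `R_j` to `R_{j+n}`, where `R_m = 0` for `m < 0`. -/
def HasDegree (n : ℤ) (f : R →ₗ[K] R) : Prop :=
  ∀ (j : ℕ) (x : R), x ∈ ℛ j → f x ∈ intGrading ℛ (j + n)

/-- The functional `ψ` is supported on `R_q`. In the graded dual of `R` such functionals have
degree `-q`. -/
def SupportedIn (q : ℕ) (ψ : Module.Dual K R) : Prop :=
  ∀ j, j ≠ q → ∀ x ∈ ℛ j, ψ x = 0

variable {ℛ}

lemma eq_zero_of_mem_intGrading {n : ℤ} (hn : n < 0) {x : R} (hx : x ∈ intGrading ℛ n) :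
    x = 0 := by
  cases n with
  | ofNat n => exact absurd hn (by simp)
  | negSucc n => exact hx

lemma SupportedIn.apply_eq_zero {q : ℕ} {ψ : Module.Dual K R} (hψ : SupportedIn ℛ q ψ) {n : ℤ}
    (hn : n ≠ q) {x : R} (hx : x ∈ intGrading ℛ n) : ψ x = 0 := by
  cases n with
  | ofNat n => exact hψ n (by rintro rfl; exact hn rfl) x hx
  | negSucc n => rw [show x = 0 from hx, map_zero]

variable [GradedAlgebra ℛ]

lemma supportedIn_comp_proj (q : ℕ) (ψ : Module.Dual K R) :
    SupportedIn ℛ q (ψ ∘ₗ GradedAlgebra.proj ℛ q) := by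
  intro j hj x hx
  have : GradedAlgebra.proj ℛ q x = 0 := proj_ne ℛ j q hj x hx
  rw [LinearMap.comp_apply, this, map_zero]

lemma eq_zero_of_proj_eq_zero {x : R} (h : ∀ n, proj ℛ n x = 0) : x = 0 := by
  obtain ⟨s, hs⟩ := exists_sum_proj ℛ x
  rw [← hs]
  exact Finset.sum_eq_zero fun n _ => h n

lemma mem_intGrading_of_supportedIn {n : ℤ} {x : R}
    (h : ∀ q : ℕ, (q : ℤ) ≠ n → ∀ ψ, SupportedIn ℛ q ψ → ψ x = 0) : x ∈ intGrading ℛ n := by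
  obtain ⟨s, hs⟩ := exists_sum_proj ℛ x
  rw [← hs]
  refine AddSubgroup.sum_mem _ fun q _ => ?_
  by_cases hq : (q : ℤ) = n
  · subst hq
    exact proj_mem ℛ q x
  · have : proj ℛ q x = 0 := (Module.forall_dual_apply_eq_zero_iff K _).1 fun ψ =>
      h q hq _ (supportedIn_comp_proj q ψ)
    rw [this]
    exact AddSubgroup.zero_mem _

lemma SupportedIn.comp_mul {q k : ℕ} {ψ : Module.Dual K R} (hψ : SupportedIn ℛ q ψ) {r : R}
    (hr : r ∈ ℛ k) (hkq : k ≤ q) : SupportedIn ℛ (q - k) (ψ ∘ₗ LinearMap.mulRight K r) :=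
  fun j hj x hx => hψ (j + k) (by omega) (x * r) (SetLike.mul_mem_graded (A := ℛ) hx hr)

lemma SupportedIn.comp_mul_eq_zero {q k : ℕ} {ψ : Module.Dual K R} (hψ : SupportedIn ℛ q ψ)
    {r : R} (hr : r ∈ ℛ k) (hkq : q < k) : ψ ∘ₗ LinearMap.mulRight K r = 0 := by
  ext x
  obtain ⟨s, hs⟩ := exists_sum_proj ℛ x
  change ψ (x * r) = 0
  rw [← hs, Finset.sum_mul, map_sum]
  exact Finset.sum_eq_zero fun j _ => hψ (j + k) (by omega) _
    (SetLike.mul_mem_graded (A := ℛ) (proj_mem ℛ j x) hr)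

end Degrees

/-! ### Cocycles -/

section Cocycles

variable {K : Type v} [Field K] {R : Type u} [Ring R] [Algebra K R]
variable (ℛ : ℕ → Submodule K R)

/-- A cocycle of degree `-d` on the dual `DR = Hom_K(R, K)` of `R`: a homogeneous map of degree
`-d` from `DR`, with `(rψ)(x) = ψ(xr)`, to the linear endomorphisms of `R` that satisfies
`G(ψ)(xr) = G(rψ)(x) + x G(ψ)(r)`. These are the cocycles that describe extensions of the graded
module `DR(d)` by `R`. -/
structure IsCocycle (d : ℤ) (G : Module.Dual K R →ₗ[K] R →ₗ[K] R) : Prop where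
  hasDegree : ∀ q ψ, SupportedIn ℛ q ψ → HasDegree ℛ (-d - q) (G ψ)
  map_mul : ∀ ψ x r, G ψ (x * r) = G (ψ ∘ₗ LinearMap.mulRight K r) x + x * G ψ r

/-- The first cosyzygy of the graded module `R` has no nonzero homogeneous element of negative
degree that is annihilated by `R_{>0}`; the elements of the cosyzygy are represented by linear
endomorphisms of `R`. -/
def NoNegativeSocle : Prop :=
  ∀ d : ℤ, 0 < d → ∀ w : R →ₗ[K] R, HasDegree ℛ (-d) w →
    (∀ k, 0 < k → ∀ r ∈ ℛ k, ∀ x, w (x * r) = x * w r) → w = 0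

/-- Every homomorphism of right `R_0`-modules `R_{>0} → R_0` is zero, where such homomorphisms are
extended by zero to `R`. -/
def RightHomVanishes : Prop :=
  ∀ f : R →ₗ[K] R, (∀ x, f x ∈ ℛ 0) → (∀ x ∈ ℛ 0, f x = 0) →
    (∀ x, ∀ r ∈ ℛ 0, f (x * r) = f x * r) → f = 0

variable {ℛ} [GradedAlgebra ℛ] [FiniteDimensional K R]

/-- A cocycle and a functional `l` on `R` give a map `D(R_0) → D(R_{>0})` of left `R_0`-modules,
whose transpose is a map `R_{>0} → R_0` of right `R_0`-modules. -/
lemma IsCocycle.apply_eq_zero {d : ℤ} {G : Module.Dual K R →ₗ[K] R →ₗ[K] R}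
    (hG : IsCocycle ℛ d G) (hd : 0 < d) (h : RightHomVanishes ℛ) {ψ : Module.Dual K R}
    (hψ : SupportedIn ℛ 0 ψ) : G ψ = 0 := by
  have hcomp : ∀ φ : Module.Dual K R, SupportedIn ℛ 0 φ → φ ∘ₗ GradedAlgebra.proj ℛ 0 = φ := by
    intro φ hφ
    ext x
    obtain ⟨s, hs⟩ := exists_sum_proj ℛ (x - proj ℛ 0 x)
    have h0 : φ (x - proj ℛ 0 x) = 0 := by
      rw [← hs, map_sum]
      refine Finset.sum_eq_zero fun j _ => ?_
      by_cases hj : j = 0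
      · rw [hj, map_sub, proj_same ℛ 0 _ (proj_mem ℛ 0 x), sub_self, map_zero]
      · exact hφ j hj _ (proj_mem ℛ j _)
    rw [map_sub, sub_eq_zero] at h0
    exact h0.symm
  have hzero : ∀ φ, SupportedIn ℛ 0 φ → ∀ r ∈ ℛ 0, G φ r = 0 := fun φ hφ r hr =>
    eq_zero_of_mem_intGrading (by simp; omega) (hG.hasDegree 0 φ hφ 0 r hr)
  ext x
  refine (Module.forall_dual_apply_eq_zero_iff K _).1 fun l => ?_
  let H : R →ₗ[K] Module.Dual K R →ₗ[K] K :=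
    LinearMap.mk₂ K (fun x φ => l (G (φ ∘ₗ GradedAlgebra.proj ℛ 0) x))
      (by simp) (by simp) (by simp [LinearMap.add_comp]) (by simp [LinearMap.smul_comp])
  let f : R →ₗ[K] R := GradedAlgebra.proj ℛ 0 ∘ₗ (Module.evalEquiv K R).symm.toLinearMap ∘ₗ H
  have hf : ∀ φ, SupportedIn ℛ 0 φ → ∀ x, φ (f x) = l (G φ x) := by
    intro φ hφ x
    have h1 : φ (f x) = φ ((Module.evalEquiv K R).symm (H x)) :=
      LinearMap.congr_fun (hcomp φ hφ) _
    rw [h1, Module.apply_evalEquiv_symm_apply]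
    exact congrArg (fun φ => l (G φ x)) (hcomp φ hφ)
  have hf0 : ∀ x, f x ∈ ℛ 0 := fun x => proj_mem ℛ 0 _
  have hext : ∀ y ∈ ℛ 0, (∀ φ, SupportedIn ℛ 0 φ → φ y = 0) → y = 0 := by
    intro y hy hφ
    refine (Module.forall_dual_apply_eq_zero_iff K _).1 fun φ => ?_
    rw [← hφ _ (supportedIn_comp_proj 0 φ)]
    exact congrArg φ (proj_same ℛ 0 y hy).symm
  rw [← hf ψ hψ, h f hf0, LinearMap.zero_apply, map_zero]
  · intro r hr
    refine hext _ (hf0 r) fun φ hφ => ?_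
    rw [hf φ hφ, hzero φ hφ r hr, map_zero]
  · intro x r hr
    have hmem : f x * r ∈ ℛ 0 := SetLike.mul_mem_graded (A := ℛ) (hf0 x) hr
    refine sub_eq_zero.1 (hext _ ((ℛ 0).sub_mem (hf0 _) hmem) fun φ hφ => ?_)
    have h2 := hf _ (hφ.comp_mul hr le_rfl) x
    rw [map_sub, hf φ hφ, hG.map_mul, hzero φ hφ r hr, mul_zero, add_zero, ← h2]
    exact sub_self _

end Cocycles

section Transpose

variable {K : Type v} [Field K] {A : Type u} [Ring A] [Algebra K A] [FiniteDimensional K A]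
variable {𝒜 : ℕ → Submodule K A} [GradedAlgebra 𝒜]

/-- Extensions of `DA(d)` by `A` as right modules are dual to such extensions of left modules: in
terms of cocycles, the trilinear form `φ(G(ψ)(a))` is read as a map in `φ` instead of `ψ`. The
transposed cocycle vanishes by induction on the degree of `φ`, because its values lie in the first
cosyzygy and their products with elements of positive degree vanish by induction. -/
lemma NoNegativeSocle.cocycle_op_eq_zero (h : NoNegativeSocle 𝒜) {d : ℤ} (hd : 0 < d)
    {G : Module.Dual K Aᵐᵒᵖ →ₗ[K] Aᵐᵒᵖ →ₗ[K] Aᵐᵒᵖ} (hG : IsCocycle (opGrading 𝒜) d G) :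
    G = 0 := by
  let o : A ≃ₗ[K] Aᵐᵒᵖ := MulOpposite.opLinearEquiv K
  let H (φ : Module.Dual K A) : A →ₗ[K] Module.Dual K A →ₗ[K] K :=
    LinearMap.mk₂ K (fun a ψ => φ (o.symm (G (ψ ∘ₗ o.symm.toLinearMap) (o a))))
      (by simp) (by simp) (by simp [LinearMap.add_comp]) (by simp [LinearMap.smul_comp])
  let F (φ : Module.Dual K A) : A →ₗ[K] A := (Module.evalEquiv K A).symm.toLinearMap ∘ₗ H φ
  have hF : ∀ (φ : Module.Dual K A) (a : A) (ψ : Module.Dual K A),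
      ψ (F φ a) = φ (o.symm (G (ψ ∘ₗ o.symm.toLinearMap) (o a))) :=
    fun φ a ψ => Module.apply_evalEquiv_symm_apply K A ψ (H φ a)
  have hext : ∀ {y z : A}, (∀ ψ : Module.Dual K A, ψ y = ψ z) → y = z := fun hyz =>
    sub_eq_zero.1 ((Module.forall_dual_apply_eq_zero_iff K _).1 fun ψ => by
      rw [map_sub, hyz ψ, sub_self])
  have hF0 : F 0 = 0 := LinearMap.ext fun a => hext fun ψ => by rw [hF]; simp
  have hmul : ∀ φ a b, F φ (a * b) = a * F φ b + F (φ ∘ₗ LinearMap.mulRight K b) a := by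
    intro φ a b
    refine hext fun ψ => ?_
    have e1 : ψ (a * F φ b) = φ (o.symm (G ((ψ ∘ₗ LinearMap.mulLeft K a) ∘ₗ o.symm.toLinearMap)
      (o b))) := hF φ b (ψ ∘ₗ LinearMap.mulLeft K a)
    rw [hF, map_add, e1, hF]
    have e2 := hG.map_mul (ψ ∘ₗ o.symm.toLinearMap) (o b) (o a)
    change φ (o.symm (G (ψ ∘ₗ o.symm.toLinearMap) (o b * o a))) = _
    rw [e2, map_add, map_add]
    rfl
  have hdeg : ∀ q φ, SupportedIn 𝒜 q φ → HasDegree 𝒜 (-(d + q)) (F φ) := by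
    intro q φ hφ j a ha
    refine mem_intGrading_of_supportedIn fun p hp ψ hψ => ?_
    rw [hF]
    have hψ' : SupportedIn (opGrading 𝒜) p (ψ ∘ₗ o.symm.toLinearMap) :=
      fun k hk x hx => hψ k hk x.unop hx
    have hmem := hG.hasDegree p _ hψ' j (o a) ha
    have hmem' : o.symm (G (ψ ∘ₗ o.symm.toLinearMap) (o a)) ∈ intGrading 𝒜 (j + (-d - p)) := by
      revert hmem
      generalize (j : ℤ) + (-d - p) = n
      intro hmem
      cases n with
      | ofNat n => exact hmem
      | negSucc n => exact congrArg o.symm (show _ = 0 from hmem)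
    exact hφ.apply_eq_zero (by omega) hmem'
  have hvan : ∀ q φ, SupportedIn 𝒜 q φ → F φ = 0 := by
    intro q
    induction q using Nat.strong_induction_on with
    | _ q ih =>
      intro φ hφ
      refine h (d + q) (by omega) _ (hdeg q φ hφ) fun k hk r hr x => ?_
      rw [hmul]
      rcases le_or_gt k q with hkq | hkq
      · rw [ih (q - k) (by omega) _ (hφ.comp_mul hr hkq), LinearMap.zero_apply, add_zero]
      · rw [hφ.comp_mul_eq_zero hr hkq, hF0, LinearMap.zero_apply, add_zero]
  refine LinearMap.ext fun ψ => LinearMap.ext fun x => o.symm.injective ?_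
  rw [LinearMap.zero_apply, LinearMap.zero_apply, map_zero]
  refine eq_zero_of_proj_eq_zero (ℛ := 𝒜) fun q => ?_
  refine (Module.forall_dual_apply_eq_zero_iff K _).1 fun φ => ?_
  have h1 := hF (φ ∘ₗ GradedAlgebra.proj 𝒜 q) (o.symm x) (ψ ∘ₗ o.toLinearMap)
  rw [hvan q _ (supportedIn_comp_proj q φ), LinearMap.zero_apply, map_zero] at h1
  exact h1.symm

end Transpose

/-! ### Coinduced modules and the first cosyzygy of the regular module -/

section Projections

variable {ι κ M N σ τ : Type*} [DecidableEq ι] [DecidableEq κ] [AddCommGroup M] [AddCommGroup N]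
  [SetLike σ M] [AddSubgroupClass σ M] [SetLike τ N] [AddSubgroupClass τ N]
  (gr : ι → σ) [DirectSum.Decomposition gr] (gr' : κ → τ) [DirectSum.Decomposition gr']

lemma proj_map (φ : M →+ N) (e : ι → κ) (he : Function.Injective e)
    (hφ : ∀ i, ∀ x ∈ gr i, φ x ∈ gr' (e i)) (i : ι) (x : M) :
    proj gr' (e i) (φ x) = φ (proj gr i x) := by
  induction x using DirectSum.Decomposition.inductionOn gr with
  | zero => simp
  | @homogeneous j m =>
    by_cases hj : j = i
    · subst hj
      rw [proj_same gr' _ _ (hφ _ _ m.2), proj_same gr _ _ m.2]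
    · rw [proj_ne gr' _ _ (fun h => hj (he h)) _ (hφ _ _ m.2), proj_ne gr _ _ hj _ m.2, map_zero]
  | add m m' h h' => rw [map_add, map_add, h, h', map_add, map_add]

lemma sum_proj_eq_of_subset {s t : Finset ι} (hst : s ⊆ t) {x : M}
    (hs : ∑ i ∈ s, proj gr i x = x) : ∑ i ∈ t, proj gr i x = x := by
  rw [← Finset.sum_subset hst, hs]
  intro i _ hi
  rw [← hs, map_sum]
  refine Finset.sum_eq_zero fun j hj => proj_ne _ j i ?_ _ (proj_mem _ _ _)
  rintro rfl
  exact hi hj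

lemma proj_smul {k : Type*} [Ring k] [Module k M] (hgr : ∀ i (c : k), ∀ x ∈ gr i, c • x ∈ gr i)
    (i : ι) (c : k) (x : M) : proj gr i (c • x) = c • proj gr i x :=
  proj_map gr gr (DistribSMul.toAddMonoidHom M c) id Function.injective_id
    (fun j y hy => hgr j c y hy) i x

/-- A grading of a finitely generated module has only finitely many nonzero components. -/
lemma exists_finset_sum_proj (k : Type*) [Ring k] [Module k M] [Module.Finite k M]
    (hgr : ∀ i (c : k), ∀ x ∈ gr i, c • x ∈ gr i) :
    ∃ T : Finset ι, ∀ x, ∑ i ∈ T, proj gr i x = x := by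
  obtain ⟨S, hS⟩ := Module.Finite.fg_top (R := k) (M := M)
  choose s hs using exists_sum_proj gr
  refine ⟨S.biUnion s, fun x => ?_⟩
  have hx : x ∈ Submodule.span k (S : Set M) := hS ▸ Submodule.mem_top
  induction hx using Submodule.span_induction with
  | mem x hx => exact sum_proj_eq_of_subset gr (Finset.subset_biUnion_of_mem s hx) (hs x)
  | zero => simp
  | add x y _ _ hx hy => simp only [map_add, Finset.sum_add_distrib, hx, hy]
  | smul c x _ hx => simp only [proj_smul gr hgr, ← Finset.smul_sum, hx]

end Projections

section Coinduced

variable {K : Type v} [Field K] {R : Type u} [Ring R] [Algebra K R]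
variable (ℛ : ℕ → Submodule K R)
variable {V : Type u} [AddCommGroup V] [Module K V] (gr : ℤ → AddSubgroup V)

/-- The left `R`-module structure `(rf)(x) = f(xr)` on `Hom_K(R, V)`. -/
@[reducible] def coindModule : Module R (R →ₗ[K] V) where
  smul r f := f ∘ₗ LinearMap.mulRight K r
  one_smul f := LinearMap.ext fun x => congrArg f (mul_one x)
  mul_smul r s f := LinearMap.ext fun x => congrArg f (mul_assoc x r s).symm
  smul_zero _ := rfl
  smul_add _ _ _ := rfl
  add_smul r s f := LinearMap.ext fun x => (congrArg f (mul_add x r s)).trans (map_add f _ _)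
  zero_smul f := LinearMap.ext fun x => (congrArg f (mul_zero x)).trans (map_zero f)

/-- The maps `R → V` that raise degrees by `n`. -/
def homGrading (n : ℤ) : AddSubgroup (R →ₗ[K] V) where
  carrier := {f | ∀ (j : ℕ) (x : R), x ∈ ℛ j → f x ∈ gr (j + n)}
  zero_mem' _ _ _ := AddSubgroup.zero_mem _
  add_mem' hf hg j x hx := AddSubgroup.add_mem _ (hf j x hx) (hg j x hx)
  neg_mem' hf j x hx := AddSubgroup.neg_mem _ (hf j x hx)

lemma smul_mem_intGrading (i : ℤ) (c : K) (x : R) (hx : x ∈ intGrading ℛ i) :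
    c • x ∈ intGrading ℛ i := by
  cases i with
  | ofNat n => exact (ℛ n).smul_mem c hx
  | negSucc n => rw [show x = 0 from hx, smul_zero]; exact AddSubgroup.zero_mem _

variable [GradedAlgebra ℛ]

lemma mul_mem_intGrading {j : ℕ} {n : ℤ} {x y : R} (hx : x ∈ ℛ j) (hy : y ∈ intGrading ℛ n) :
    x * y ∈ intGrading ℛ (j + n) :=
  (regular ℛ).smul_mem j n x y hx hy

noncomputable instance intGradingDecomposition : DirectSum.Decomposition (intGrading ℛ) :=
  (regular ℛ).decomposition

variable [FiniteDimensional K R] [DirectSum.Decomposition gr]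

/-- The maps `R → V` are sums of homogeneous ones if `R` and `V` are finite-dimensional. -/
@[reducible] noncomputable def homDecomposition [FiniteDimensional K V]
    (hgr : ∀ i (c : K), ∀ x ∈ gr i, c • x ∈ gr i) :
    DirectSum.Decomposition (homGrading ℛ gr) :=
  have hR := exists_finset_sum_proj ℛ K fun i c x hx => (ℛ i).smul_mem c hx
  decompositionOfProj _
    (fun n =>
      { toFun f :=
          { toFun x := ∑ j ∈ hR.choose, proj gr (j + n) (f (proj ℛ j x))
            map_add' x y := by simp only [map_add, Finset.sum_add_distrib]
            map_smul' c x := by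
              simp only [proj_smul ℛ (fun i c x hx => (ℛ i).smul_mem c hx), map_smul,
                proj_smul gr hgr, Finset.smul_sum, RingHom.id_apply] }
        map_zero' := by ext; simp
        map_add' f g := by ext; simp [Finset.sum_add_distrib] })
    (by
      intro n f j x hx
      refine AddSubgroup.sum_mem _ fun i _ => ?_
      by_cases hij : i = j
      · subst hij
        exact proj_mem gr _ _
      · rw [proj_ne ℛ j i (Ne.symm hij) x hx, map_zero, map_zero]
        exact AddSubgroup.zero_mem _)
    (by
      intro n f hf
      ext x
      refine (Finset.sum_congr rfl fun j _ =>
        proj_same gr _ _ (hf j _ (proj_mem ℛ j x))).trans ?_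
      rw [← map_sum, hR.choose_spec x])
    (by
      intro m n hmn f hf
      ext x
      exact Finset.sum_eq_zero fun j _ =>
        proj_ne gr _ _ (by omega) _ (hf j _ (proj_mem ℛ j x)))
    (by
      intro f
      classical
      obtain ⟨T, hT⟩ := exists_finset_sum_proj gr K hgr
      -- all differences of a degree of `V` and a degree of `R`
      refine ⟨(T ×ˢ hR.choose).image fun p => p.1 - p.2, ?_⟩
      ext x
      rw [LinearMap.sum_apply]
      refine Finset.sum_comm.trans ?_
      conv_rhs => rw [← hR.choose_spec x, map_sum]
      refine Finset.sum_congr rfl fun j hj => ?_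
      change ∑ n ∈ _, proj gr (j + n) (f (proj ℛ j x)) = _
      rw [← Finset.sum_image (f := fun m => proj gr m (f (proj ℛ j x)))
        (g := fun n : ℤ => (j : ℤ) + n) (fun a _ b _ h => add_left_cancel h)]
      refine sum_proj_eq_of_subset gr (s := T) (fun t ht => ?_) (hT _)
      refine Finset.mem_image.2 ⟨t - j, Finset.mem_image.2 ⟨(t, j), ?_, rfl⟩, by ring⟩
      exact Finset.mem_product.2 ⟨ht, hj⟩)

/-- The graded left `R`-module `Hom_K(R, V)` coinduced from a finite-dimensional graded vector
space `V`. -/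
noncomputable def coind [FiniteDimensional K V]
    (hgr : ∀ i (c : K), ∀ x ∈ gr i, c • x ∈ gr i) : GrMod ℛ where
  carrier := R →ₗ[K] V
  module := coindModule
  gr := homGrading ℛ gr
  decomposition := homDecomposition ℛ gr hgr
  smul_mem i n r f hr hf j x hx := by
    have h := hf (j + i) (x * r) (SetLike.mul_mem_graded (A := ℛ) hx hr)
    rw [Nat.cast_add, add_assoc] at h
    exact h

/-- The graded module `Hom_K(R, R)` coinduced from the graded vector space `R`. -/
noncomputable def coindRegular : GrMod ℛ :=
  coind ℛ (intGrading ℛ) (smul_mem_intGrading ℛ)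

end Coinduced

section Cosyzygy

variable {K : Type v} [Field K] {R : Type u} [Ring R] [Algebra K R]
lemma lin_injective_of_mono {ℛ : ℕ → Submodule K R} {X Y : GrMod ℛ} (f : X ⟶ Y) [Mono f] :
    Function.Injective f.lin := by
  refine (injective_iff_map_eq_zero _).2 fun x hx => ?_
  have h : X.subι f.lin.ker (GrMod.ker_homogeneous f) = 0 := by
    rw [← cancel_mono f, zero_comp]
    exact GrMod.hom_ext fun z => z.2
  exact congrArg (fun g => GrMod.Hom.lin g (⟨x, hx⟩ : f.lin.ker)) h

variable (ℛ : ℕ → Submodule K R) [GradedAlgebra ℛ]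

variable (K R) in
/-- The linear endomorphisms of `R` that vanish at `1`. They represent the classes of all
endomorphisms modulo the right multiplications `x ↦ xb`. -/
def normalizedMaps : Submodule K (R →ₗ[K] R) where
  carrier := {c | c 1 = 0}
  zero_mem' := rfl
  add_mem' {a b} ha hb := by
    change a 1 + b 1 = 0
    rw [show a 1 = 0 from ha, show b 1 = 0 from hb, add_zero]
  smul_mem' k a ha := by
    change k • a 1 = 0
    rw [show a 1 = 0 from ha, smul_zero]

/-- The module structure on the quotient of `Hom_K(R, R)` by the right multiplications, in terms of
representatives that vanish at `1`. -/
@[reducible] def normalizedModule : Module R (normalizedMaps K R) where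
  smul r c := ⟨c.1 ∘ₗ LinearMap.mulRight K r - LinearMap.mulRight K (c.1 r), by
    change c.1 (1 * r) - 1 * c.1 r = 0
    rw [one_mul, one_mul, sub_self]⟩
  one_smul c := Subtype.ext <| LinearMap.ext fun x => by
    change c.1 (x * 1) - x * c.1 1 = c.1 x
    rw [show c.1 1 = 0 from c.2, mul_one, mul_zero, sub_zero]
  mul_smul r s c := Subtype.ext <| LinearMap.ext fun x => by
    change c.1 (x * (r * s)) - x * c.1 (r * s) =
      c.1 (x * r * s) - x * r * c.1 s - x * (c.1 (r * s) - r * c.1 s)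
    rw [mul_sub, mul_assoc, mul_assoc]
    abel
  smul_zero r := Subtype.ext <| LinearMap.ext fun x => by
    change (0 : R) - x * 0 = 0
    rw [mul_zero, sub_zero]
  smul_add r c e := Subtype.ext <| LinearMap.ext fun x => by
    change c.1 (x * r) + e.1 (x * r) - x * (c.1 r + e.1 r) =
      c.1 (x * r) - x * c.1 r + (e.1 (x * r) - x * e.1 r)
    rw [mul_add]
    abel
  add_smul r s c := Subtype.ext <| LinearMap.ext fun x => by
    change c.1 (x * (r + s)) - x * c.1 (r + s) =
      c.1 (x * r) - x * c.1 r + (c.1 (x * s) - x * c.1 s)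
    rw [mul_add, map_add, map_add, mul_add]
    abel
  zero_smul c := Subtype.ext <| LinearMap.ext fun x => by
    change c.1 (x * 0) - x * c.1 0 = 0
    rw [mul_zero, map_zero, mul_zero, sub_zero]

variable [FiniteDimensional K R]

lemma proj_apply_one (n : ℤ) (c : R →ₗ[K] R) :
    letI := homDecomposition ℛ (intGrading ℛ) (smul_mem_intGrading ℛ)
    proj (intGrading ℛ) n (c 1) = proj (homGrading ℛ (intGrading ℛ)) n c 1 :=
  letI := homDecomposition ℛ (intGrading ℛ) (smul_mem_intGrading ℛ)
  proj_map (homGrading ℛ (intGrading ℛ)) (intGrading ℛ)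
    (LinearMap.applyₗ (R := K) (1 : R)).toAddMonoidHom id Function.injective_id
    (fun i f hf => by
      have := hf 0 1 (SetLike.GradedOne.one_mem)
      rwa [Nat.cast_zero, zero_add] at this) n c

/-- The normalized maps of degree `n`. -/
def normalizedGrading (n : ℤ) : AddSubgroup (normalizedMaps K R) where
  carrier := {c | c.1 ∈ homGrading ℛ (intGrading ℛ) n}
  zero_mem' := AddSubgroup.zero_mem (homGrading ℛ (intGrading ℛ) n)
  add_mem' := AddSubgroup.add_mem (homGrading ℛ (intGrading ℛ) n)
  neg_mem' := AddSubgroup.neg_mem (homGrading ℛ (intGrading ℛ) n)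

/-- The component of degree `n` of a normalized map. -/
noncomputable def normalizedProj (n : ℤ) : normalizedMaps K R →+ normalizedMaps K R :=
  letI := homDecomposition ℛ (intGrading ℛ) (smul_mem_intGrading ℛ)
  { toFun c := ⟨proj (homGrading ℛ (intGrading ℛ)) n c.1, by
      change proj (homGrading ℛ (intGrading ℛ)) n c.1 1 = 0
      rw [← proj_apply_one, show c.1 1 = 0 from c.2, map_zero]⟩
    map_zero' := Subtype.ext (map_zero (proj (homGrading ℛ (intGrading ℛ)) n))
    map_add' c e := Subtype.ext (map_add (proj (homGrading ℛ (intGrading ℛ)) n) c.1 e.1) }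

/-- The decomposition of the space of normalized maps into homogeneous components. -/
@[reducible] noncomputable def normalizedDecomposition :
    DirectSum.Decomposition (normalizedGrading ℛ) :=
  letI := homDecomposition ℛ (intGrading ℛ) (smul_mem_intGrading ℛ)
  decompositionOfProj (normalizedGrading ℛ) (normalizedProj ℛ)
    (fun n c => proj_mem (homGrading ℛ (intGrading ℛ)) n c.1)
    (fun n c hc => Subtype.ext (proj_same (homGrading ℛ (intGrading ℛ)) n _ hc))
    (fun i j h c hc => Subtype.ext (proj_ne (homGrading ℛ (intGrading ℛ)) i j h _ hc))
    (fun c => by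
      obtain ⟨s, hs⟩ := exists_sum_proj (homGrading ℛ (intGrading ℛ)) c.1
      refine ⟨s, Subtype.ext ?_⟩
      rw [AddSubmonoidClass.coe_finsetSum]
      exact hs)

/-- The cokernel of the embedding of `R` into the injective graded module `Hom_K(R, R)` that sends
`b` to `x ↦ xb`. -/
noncomputable def cosyzygy : GrMod ℛ where
  carrier := normalizedMaps K R
  module := normalizedModule
  gr := normalizedGrading ℛ
  decomposition := normalizedDecomposition ℛ
  smul_mem i n r c hr hc j x hx := by
    have h1 := hc (j + i) (x * r) (SetLike.mul_mem_graded (A := ℛ) hx hr)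
    have h2 := mul_mem_intGrading ℛ hx (hc i r hr)
    rw [Nat.cast_add, add_assoc] at h1
    exact AddSubgroup.sub_mem _ h1 h2

/-- The embedding of `R` into `Hom_K(R, R)`. -/
noncomputable def toCoindRegular : regular ℛ ⟶ coindRegular ℛ where
  lin :=
    { toFun := fun b : R => LinearMap.mulRight K b
      map_add' := fun a b : R => LinearMap.ext fun x => mul_add x a b
      map_smul' := fun r (b : R) => LinearMap.ext fun x => (mul_assoc x r b).symm }
  map_mem _ _ hb _ _ hx := mul_mem_intGrading ℛ hx hb

/-- The projection of `Hom_K(R, R)` to the cosyzygy. -/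
noncomputable def toCosyzygy : coindRegular ℛ ⟶ cosyzygy ℛ where
  lin :=
    { toFun := fun c : R →ₗ[K] R => (⟨c - LinearMap.mulRight K (c 1), by
        change c 1 - 1 * c 1 = 0
        rw [one_mul, sub_self]⟩ : normalizedMaps K R)
      map_add' := fun c e : R →ₗ[K] R => Subtype.ext <| LinearMap.ext fun x => by
        change c x + e x - x * (c 1 + e 1) = c x - x * c 1 + (e x - x * e 1)
        rw [mul_add]
        abel
      map_smul' := fun r (c : R →ₗ[K] R) => Subtype.ext <| LinearMap.ext fun x => by
        change c (x * r) - x * c (1 * r) = c (x * r) - x * r * c 1 - x * (c r - r * c 1)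
        rw [mul_sub, one_mul, mul_assoc]
        abel }
  map_mem n c hc j x hx := by
    have h1 := hc 0 1 (SetLike.GradedOne.one_mem)
    rw [Nat.cast_zero, zero_add] at h1
    exact AddSubgroup.sub_mem _ (hc j x hx) (mul_mem_intGrading ℛ hx h1)

lemma toCoindRegular_toCosyzygy : toCoindRegular ℛ ≫ toCosyzygy ℛ = 0 :=
  GrMod.hom_ext fun b : R => Subtype.ext <| LinearMap.ext fun x => by
    change x * b - x * (1 * b) = 0
    rw [one_mul, sub_self]

lemma toCoindRegular_injective : Function.Injective (toCoindRegular ℛ).lin :=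
  fun (a b : R) (h : LinearMap.mulRight K a = LinearMap.mulRight K b) => by
    have h1 : 1 * a = 1 * b := LinearMap.congr_fun h 1
    rwa [one_mul, one_mul] at h1

lemma toCosyzygy_surjective : Function.Surjective (toCosyzygy ℛ).lin :=
  fun c : normalizedMaps K R => ⟨c.1, Subtype.ext <| LinearMap.ext fun x => by
    change c.1 x - x * c.1 1 = c.1 x
    rw [show c.1 1 = 0 from c.2, mul_zero, sub_zero]⟩

/-- The sequence `R → Hom_K(R, R) → cosyzygy`. -/
noncomputable def cosyzygySequence : ShortComplex (GrMod ℛ) :=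
  ShortComplex.mk (toCoindRegular ℛ) (toCosyzygy ℛ) (toCoindRegular_toCosyzygy ℛ)

lemma cosyzygySequence_shortExact : (cosyzygySequence ℛ).ShortExact where
  exact := ShortComplex.exact_of_f_is_kernel _ <|
    GrMod.isLimitOfInjective (toCoindRegular ℛ) (toCosyzygy ℛ) (toCoindRegular_toCosyzygy ℛ)
      (toCoindRegular_injective ℛ) fun (c : R →ₗ[K] R) hc => ⟨c 1, LinearMap.ext fun x => by
        have h : c x - x * c 1 = 0 :=
          LinearMap.congr_fun (congrArg Subtype.val (show _ = (0 : normalizedMaps K R) from hc)) x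
        exact (sub_eq_zero.1 h).symm⟩
  mono_f := ⟨fun a b hab => GrMod.hom_ext fun z => toCoindRegular_injective ℛ
    (congrArg (fun f => GrMod.Hom.lin f z) hab)⟩
  epi_g := ⟨fun a b hab => GrMod.hom_ext fun z => by
    obtain ⟨y, rfl⟩ := toCosyzygy_surjective ℛ z
    exact congrArg (fun f => GrMod.Hom.lin f y) hab⟩

/-- Homomorphisms from `X` to `Hom_K(R, R)` are the same as degree-preserving linear maps from `X`
to `R`, and these extend along injections. -/
instance coindRegular_injective : Injective (coindRegular ℛ) where
  factors {X Y} g f _ := by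
    let _ : Module K X := Module.compHom X (algebraMap K R)
    let _ : Module K Y := Module.compHom Y (algebraMap K R)
    have hYgr : ∀ i (c : K), ∀ y ∈ Y.gr i, c • y ∈ Y.gr i := fun i c y hy => by
      have := Y.smul_mem 0 i (algebraMap K R c) y (SetLike.algebraMap_mem_graded ℛ c) hy
      rwa [Nat.cast_zero, zero_add] at this
    let fK : X →ₗ[K] Y :=
      { toFun := f.lin, map_add' := map_add f.lin, map_smul' := fun c x => map_smul f.lin _ x }
    obtain ⟨l, hl⟩ := LinearMap.exists_leftInverse_of_injective fK
      (LinearMap.ker_eq_bot.2 (lin_injective_of_mono f))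
    have hl' : ∀ x, l (f.lin x) = x := fun x => LinearMap.congr_fun hl x
    let G : X → R →ₗ[K] R := fun x => g.lin x
    have hGsmul : ∀ r x y, G (r • x) y = G x (y * r) := fun r x y =>
      LinearMap.congr_fun (show G (r • x) = G x ∘ₗ LinearMap.mulRight K r from
        map_smul g.lin r x) y
    let ev : X →ₗ[K] R :=
      { toFun x := G x 1
        map_add' x y := LinearMap.congr_fun (show G (x + y) = G x + G y from map_add g.lin x y) 1
        map_smul' c x := by
          change G (algebraMap K R c • x) 1 = c • G x 1
          rw [hGsmul, one_mul, Algebra.algebraMap_eq_smul_one, map_smul] }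
    have hev : ∀ i, ∀ x ∈ X.gr i, ev x ∈ intGrading ℛ i := fun i x hx => by
      have := g.map_mem i x hx 0 1 (SetLike.GradedOne.one_mem)
      rwa [Nat.cast_zero, zero_add] at this
    obtain ⟨T, hT⟩ := exists_finset_sum_proj (intGrading ℛ) K (smul_mem_intGrading ℛ)
    -- the degree-preserving part of the linear extension of `ev`
    let θ : Y →ₗ[K] R :=
      { toFun y := ∑ n ∈ T, proj (intGrading ℛ) n (ev (l (proj Y.gr n y)))
        map_add' x y := by simp only [map_add, Finset.sum_add_distrib]
        map_smul' c y := by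
          simp only [proj_smul Y.gr hYgr, map_smul, proj_smul _ (smul_mem_intGrading ℛ),
            Finset.smul_sum, RingHom.id_apply] }
    have hθ : ∀ i, ∀ y ∈ Y.gr i, θ y ∈ intGrading ℛ i := fun i y hy => by
      refine AddSubgroup.sum_mem _ fun n _ => ?_
      by_cases hn : n = i
      · subst hn
        exact proj_mem (intGrading ℛ) _ _
      · rw [proj_ne Y.gr i n (Ne.symm hn) y hy, map_zero, map_zero, map_zero]
        exact AddSubgroup.zero_mem _
    have hθf : ∀ x, θ (f.lin x) = ev x := fun x => by
      refine (Finset.sum_congr rfl fun n _ => ?_).trans (hT (ev x))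
      rw [← GrMod.lin_proj, hl']
      have h1 := proj_map X.gr (intGrading ℛ) ev.toAddMonoidHom id Function.injective_id hev n x
      exact proj_same _ _ _ (hev _ _ (proj_mem _ _ _)) |>.trans h1.symm
    have hcomm : ∀ (c : K) (x : R) (y : Y), (c • x) • y = c • (x • y) := fun c x y => by
      rw [Algebra.smul_def, mul_smul]
      rfl
    refine ⟨⟨
      { toFun y := ({ toFun x := θ (x • y)
                      map_add' a b := by rw [add_smul, map_add]
                      map_smul' c x := by rw [hcomm, map_smul]; rfl } : R →ₗ[K] R)
        map_add' y z := LinearMap.ext fun x =>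
          (congrArg θ (smul_add x y z)).trans (map_add θ _ _)
        map_smul' r y := LinearMap.ext fun x => congrArg θ (mul_smul x r y).symm }, ?_⟩, ?_⟩
    · intro n y hy j x hx
      exact hθ _ _ (Y.smul_mem j n x y hx hy)
    · refine GrMod.hom_ext fun z => LinearMap.ext fun x => ?_
      change θ (x • f.lin z) = G z x
      rw [← map_smul, hθf]
      change G (x • z) 1 = G z x
      rw [hGsmul, one_mul]

lemma cosyzygy_injective (h : HasInjectiveDimensionLE (regular ℛ) 1) :
    Injective (cosyzygy ℛ) :=
  injective_iff_hasInjectiveDimensionLT_one.2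
    (((cosyzygySequence_shortExact ℛ).hasInjectiveDimensionLT_X₃_iff 0
      (coindRegular_injective ℛ)).2 h)

end Cosyzygy

/-! ### Consequences of the injectivity of the cosyzygy -/

section Splitting

variable {K : Type v} [Field K] {R : Type u} [Ring R] [Algebra K R]
variable (ℛ : ℕ → Submodule K R)

lemma smul_mem_normalizedGrading (i : ℤ) (c : K) (y : normalizedMaps K R)
    (hy : y ∈ normalizedGrading ℛ i) : c • y ∈ normalizedGrading ℛ i :=
  fun j x hx => smul_mem_intGrading ℛ _ c _ (hy j x hx)

variable [GradedAlgebra ℛ] [FiniteDimensional K R]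

noncomputable instance : DirectSum.Decomposition (normalizedGrading ℛ) :=
  normalizedDecomposition ℛ

/-- The graded module `Hom_K(R, C)` coinduced from the cosyzygy `C` of `R`. -/
noncomputable def coindCosyzygy : GrMod ℛ :=
  coind ℛ (normalizedGrading ℛ) (smul_mem_normalizedGrading ℛ)

lemma algebraMap_smul_cosyzygy (c : K) (y : normalizedMaps K R) :
    (show normalizedMaps K R from algebraMap K R c • (show cosyzygy ℛ from y)) = c • y :=
  Subtype.ext <| LinearMap.ext fun x => by
    change y.1 (x * algebraMap K R c) - x * y.1 (algebraMap K R c) = c • y.1 x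
    rw [Algebra.algebraMap_eq_smul_one, map_smul, show y.1 1 = 0 from y.2, mul_smul_comm, mul_one,
      map_smul, smul_zero, mul_zero, sub_zero]

/-- The action of `R` on an element of the cosyzygy, as a linear map. -/
noncomputable def actionMap (y : cosyzygy ℛ) : R →ₗ[K] normalizedMaps K R where
  toFun x := (x • y : cosyzygy ℛ)
  map_add' a b := add_smul a b y
  map_smul' c a := by
    have h : (c • a) • y = algebraMap K R c • (a • y) := by rw [Algebra.smul_def, mul_smul]
    exact h.trans (algebraMap_smul_cosyzygy ℛ c (a • y))

/-- The embedding of the cosyzygy `C` into `Hom_K(R, C)`. -/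
noncomputable def toCoindCosyzygy : cosyzygy ℛ ⟶ coindCosyzygy ℛ where
  lin :=
    { toFun := fun y => actionMap ℛ y
      map_add' := fun y z => LinearMap.ext fun x => smul_add x y z
      map_smul' := fun r y => LinearMap.ext fun x => (mul_smul x r y).symm }
  map_mem n y hy j x hx := (cosyzygy ℛ).smul_mem j n x y hx hy

instance : Mono (toCoindCosyzygy ℛ) :=
  ⟨fun a b hab => GrMod.hom_ext fun z => by
    have h : (1 : R) • a.lin z = (1 : R) • b.lin z :=
      LinearMap.congr_fun (show actionMap ℛ (a.lin z) = actionMap ℛ (b.lin z) from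
        congrArg (fun f => GrMod.Hom.lin f z) hab) 1
    rwa [one_smul, one_smul] at h⟩

/-- If the cosyzygy `C` is injective, it is a retract of `Hom_K(R, C)`. For `y` in `C`, the
retraction sends the maps `x ↦ ψ(x)y` with `ψ` in the dual of `R` to the values of a cocycle, and
an element that is annihilated by `R_{>0}` is a sum of values of such cocycles at functionals
supported on `R_0`. -/
lemma noNegativeSocle_of_cocycles_vanish (h : HasInjectiveDimensionLE (regular ℛ) 1)
    (hcoc : ∀ d : ℤ, 0 < d → ∀ G, IsCocycle ℛ d G → ∀ ψ, SupportedIn ℛ 0 ψ → G ψ = 0) :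
    NoNegativeSocle ℛ := by
  intro d hd w hw hsoc
  have := cosyzygy_injective ℛ h
  let ρ : coindCosyzygy ℛ ⟶ cosyzygy ℛ := Injective.factorThru (𝟙 _) (toCoindCosyzygy ℛ)
  have hρ : ∀ y, ρ.lin ((toCoindCosyzygy ℛ).lin y) = y := fun y =>
    congrArg (fun f => GrMod.Hom.lin f y) (Injective.comp_factorThru (𝟙 _) (toCoindCosyzygy ℛ))
  -- the retraction as a linear map
  let P : (R →ₗ[K] normalizedMaps K R) →ₗ[K] normalizedMaps K R :=
    { toFun := fun f => ρ.lin f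
      map_add' := fun f f' => map_add ρ.lin f f'
      map_smul' := fun c f => by
        let f' : coindCosyzygy ℛ := f
        let cf : coindCosyzygy ℛ := c • f
        have e : algebraMap K R c • f' = cf :=
          LinearMap.ext fun x => by
            change f (x * algebraMap K R c) = c • f x
            rw [Algebra.algebraMap_eq_smul_one, mul_smul_comm, mul_one, map_smul]
        change ρ.lin cf = _
        rw [← e]
        exact (map_smul ρ.lin (algebraMap K R c) f').trans (algebraMap_smul_cosyzygy ℛ c _) }
  let y : normalizedMaps K R := ⟨w, eq_zero_of_mem_intGrading (by simp; omega)
    (hw 0 1 SetLike.GradedOne.one_mem)⟩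
  let a : R →ₗ[K] normalizedMaps K R := actionMap ℛ y
  have hP : P a = y := hρ y
  have hpos : ∀ k, 0 < k → ∀ r ∈ ℛ k, a r = 0 := fun k hk r hr =>
    Subtype.ext <| LinearMap.ext fun x => sub_eq_zero.2 (hsoc k hk r hr x)
  have ha0 : ∀ x, a (proj ℛ 0 x) = a x := by
    intro x
    obtain ⟨s, hs⟩ := exists_sum_proj ℛ (x - proj ℛ 0 x)
    rw [eq_comm, ← sub_eq_zero, ← map_sub a, ← hs, map_sum]
    refine Finset.sum_eq_zero fun j _ => ?_
    rcases Nat.eq_zero_or_pos j with rfl | hj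
    · rw [map_sub (proj ℛ 0), proj_same ℛ 0 _ (proj_mem ℛ 0 x), sub_self, map_zero]
    · exact hpos j hj _ (proj_mem ℛ j _)
  let G (z : normalizedMaps K R) : Module.Dual K R →ₗ[K] R →ₗ[K] R :=
    LinearMap.mk₂ K (fun ψ x => (P (ψ.smulRight z)).1 x)
      (fun ψ ψ' x => by
        rw [show (ψ + ψ').smulRight z = ψ.smulRight z + ψ'.smulRight z from
          LinearMap.ext fun x => add_smul (ψ x) (ψ' x) z, map_add]
        rfl)
      (fun c ψ x => by
        rw [show (c • ψ).smulRight z = c • ψ.smulRight z from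
          LinearMap.ext fun x => mul_smul c (ψ x) z, map_smul]
        rfl)
      (fun ψ x x' => map_add _ x x')
      (fun c ψ x => map_smul _ c x)
  have hG : ∀ z ∈ normalizedGrading ℛ (-d), IsCocycle ℛ d (G z) := by
    intro z hz
    constructor
    · intro q ψ hψ
      refine ρ.map_mem (-d - q) (ψ.smulRight z) fun j x hx => ?_
      by_cases hj : j = q
      · subst hj
        rw [show (j : ℤ) + (-d - j) = -d by ring]
        exact smul_mem_normalizedGrading ℛ _ _ _ hz
      · change ψ x • z ∈ _
        rw [hψ j hj x hx, zero_smul]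
        exact AddSubgroup.zero_mem _
    · intro ψ x r
      have e := LinearMap.congr_fun (congrArg Subtype.val
        (map_smul ρ.lin r (show coindCosyzygy ℛ from ψ.smulRight z))) x
      exact (sub_eq_iff_eq_add.1 e.symm :)
  let b := Module.finBasis K R
  have hsum : a = ∑ i, (b.coord i ∘ₗ GradedAlgebra.proj ℛ 0).smulRight (a (proj ℛ 0 (b i))) := by
    ext1 x
    rw [LinearMap.sum_apply]
    simp only [ha0]
    calc a x = a (∑ i, b.repr (proj ℛ 0 x) i • b i) := by rw [b.sum_repr, ha0]
      _ = _ := by rw [map_sum]; exact Finset.sum_congr rfl fun i _ => map_smul a _ _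
  have hy : y = 0 := by
    rw [← hP, hsum, map_sum]
    refine Finset.sum_eq_zero fun i _ => Subtype.ext ?_
    refine hcoc d hd _ (hG (a (proj ℛ 0 (b i))) ?_) _ (supportedIn_comp_proj 0 (b.coord i))
    have := (cosyzygy ℛ).smul_mem 0 (-d) (proj ℛ 0 (b i)) y (proj_mem ℛ 0 _) hw
    rwa [Nat.cast_zero, zero_add] at this
  exact congrArg Subtype.val hy

end Splitting

/-! ### The invariant -/

section Invariant

variable {K : Type v} [Field K] {R : Type u} [Ring R] [Algebra K R]
variable (ℛ : ℕ → Submodule K R) [GradedAlgebra ℛ] [FiniteDimensional K R]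

variable {ℛ} in
/-- `(R/J)(i)` is generated by an element of degree `-i` that is annihilated by `R_{>0}`. -/
lemma hom_top_shift_eq_zero {Z : GrMod ℛ} (i : ℤ)
    (hZ : ∀ z ∈ Z.gr (-i), (∀ k, 0 < k → ∀ r ∈ ℛ k, r • z = 0) → z = 0)
    (f : (top ℛ).shift i ⟶ Z) : f = 0 := by
  let J : Submodule R R := Ring.jacobson R
  let F : R ⧸ J →ₗ[R] Z := f.lin
  have hone : F (J.mkQ 1) = 0 := by
    refine hZ _ (f.map_mem (-i) (J.mkQ 1) ?_) fun k hk r hr => ?_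
    · change J.mkQ 1 ∈ (top ℛ).gr (-i + i)
      rw [neg_add_cancel]
      have h1 : (1 : R) ∈ ℛ 0 := SetLike.GradedOne.one_mem
      exact ⟨(1 : R), h1, rfl⟩
    · have hrJ : r ∈ J := mem_jacobson_of_component_zero ℛ r (proj_ne ℛ k 0 (by omega) r hr)
      have hr0 : J.mkQ r = 0 := (Submodule.Quotient.mk_eq_zero J).2 hrJ
      rw [← map_smul, ← map_smul, smul_eq_mul, mul_one, hr0, map_zero]
  refine GrMod.hom_ext fun x => ?_
  obtain ⟨r, rfl⟩ := J.mkQ_surjective x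
  change F (J.mkQ r) = 0
  rw [← mul_one r, ← smul_eq_mul, map_smul, map_smul, hone, smul_zero]

/-- For `i > 0`, homomorphisms from `(R/J)(i)` to `R` vanish for degree reasons, and the group
`Ext¹` is a quotient of the group of homomorphisms to the cosyzygy. -/
lemma NoNegativeSocle.gInvariant_le_zero (hN : NoNegativeSocle ℛ)
    (h : HasInjectiveDimensionLE (regular ℛ) 1) : gInvariant ℛ (regular ℛ) ≤ 0 := by
  let := HasExt.standard (GrMod ℛ)
  refine sSup_le ?_
  rintro _ ⟨i, rfl, n, hn⟩
  rw [← WithBot.coe_zero, WithBot.coe_le_coe, ← WithTop.coe_zero, WithTop.coe_le_coe]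
  by_contra hi
  rw [not_le] at hi
  refine not_subsingleton_iff_nontrivial.2 hn ?_
  match n with
  | 0 =>
    have : Subsingleton ((top ℛ).shift i ⟶ regular ℛ) := subsingleton_of_forall_eq 0
      (hom_top_shift_eq_zero i fun z hz _ =>
        eq_zero_of_mem_intGrading (R := R) (ℛ := ℛ) (n := -i) (by omega) hz)
    exact Abelian.Ext.homEquiv₀.subsingleton
  | 1 =>
    refine subsingleton_of_forall_eq 0 fun e => ?_
    obtain ⟨x, rfl⟩ := Abelian.Ext.covariant_sequence_exact₁ ((top ℛ).shift i)
      (cosyzygySequence_shortExact ℛ) e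
      (have := coindRegular_injective ℛ; Abelian.Ext.eq_zero_of_injective (I := coindRegular ℛ) _)
      (zero_add 1)
    have hx : x = 0 := by
      obtain ⟨f, rfl⟩ := Abelian.Ext.homEquiv₀.symm.surjective x
      have : f = 0 := hom_top_shift_eq_zero (Z := cosyzygy ℛ) i
        (fun (z : normalizedMaps K R) hz hr => Subtype.ext <|
          hN i hi z.1 hz fun k hk r hrk x => sub_eq_zero.1
            (LinearMap.congr_fun (congrArg Subtype.val
              (show _ = (0 : normalizedMaps K R) from hr k hk r hrk)) x)) f
      rw [this]
      exact Abelian.Ext.mk₀_zero _ _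
    subst hx
    exact Abelian.Ext.zero_comp (β := (cosyzygySequence_shortExact ℛ).extClass) ..
  | n + 2 =>
    have : HasInjectiveDimensionLT (regular ℛ) 2 := h
    exact HasInjectiveDimensionLT.subsingleton (regular ℛ) 2 (n + 2) (by omega) _

end Invariant

/-! ### The two vanishing conditions -/

section Vanishing

variable {K : Type v} [Field K] {A : Type u} [Ring A] [Algebra K A]
variable (𝒜 : ℕ → Submodule K A) [GradedAlgebra 𝒜]

lemma rightHomVanishes_op (h : ∀ f : LeftHom 𝒜, f = 0) : RightHomVanishes (opGrading 𝒜) := by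
  intro f hf hf0 hmul
  let F : LeftHom 𝒜 :=
    { toFun x := ⟨(f (MulOpposite.op x.1)).unop, hf _⟩
      map_add' x y := Subtype.ext
        (congrArg MulOpposite.unop (map_add f (MulOpposite.op x.1) (MulOpposite.op y.1)))
      map_smul' a x := Subtype.ext
        (congrArg MulOpposite.unop (hmul (MulOpposite.op x.1) (MulOpposite.op a.1) a.2)) }
  ext x
  have hx : x.unop - proj 𝒜 0 x.unop ∈ positivePart 𝒜 := by
    change proj 𝒜 0 (x.unop - proj 𝒜 0 x.unop) = 0
    rw [map_sub, proj_same 𝒜 0 _ (proj_mem 𝒜 0 _), sub_self]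
  have h1 : (f (MulOpposite.op (x.unop - proj 𝒜 0 x.unop))).unop = 0 :=
    congrArg Subtype.val (LinearMap.congr_fun (h F) ⟨_, hx⟩)
  rw [MulOpposite.op_sub, map_sub, MulOpposite.op_unop,
    hf0 (MulOpposite.op (proj 𝒜 0 x.unop)) (proj_mem 𝒜 0 x.unop), sub_zero] at h1
  exact MulOpposite.unop_injective h1

lemma rightHomVanishes (h : ∀ f : RightHom 𝒜, f = 0) : RightHomVanishes 𝒜 := by
  intro f hf hf0 hmul
  let F : RightHom 𝒜 :=
    { toFun x := ⟨MulOpposite.op (f x.1.unop), hf _⟩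
      map_add' x y := Subtype.ext
        (congrArg MulOpposite.op (map_add f x.1.unop y.1.unop))
      map_smul' a x := Subtype.ext
        (congrArg MulOpposite.op (hmul x.1.unop a.1.unop a.2)) }
  ext x
  have hx : MulOpposite.op (x - proj 𝒜 0 x) ∈ positivePart (opGrading 𝒜) := by
    have e := proj_map 𝒜 (opGrading 𝒜) (MulOpposite.opAddEquiv : A ≃+ Aᵐᵒᵖ).toAddMonoidHom id
      Function.injective_id (fun _ _ hy => hy) 0 (x - proj 𝒜 0 x)
    rw [map_sub (proj 𝒜 0), proj_same 𝒜 0 _ (proj_mem 𝒜 0 x), sub_self, map_zero] at e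
    exact e
  have h1 : MulOpposite.op (f (x - proj 𝒜 0 x)) = 0 :=
    congrArg Subtype.val (LinearMap.congr_fun (h F) ⟨_, hx⟩)
  have h2 := MulOpposite.op_injective h1
  rwa [map_sub, hf0 _ (proj_mem 𝒜 0 x), sub_zero] at h2

end Vanishing

end GradedIG

theorem mainTheorem5 {K : Type v} [Field K] {A : Type u} [Ring A] [Algebra K A]
    [FiniteDimensional K A] (𝒜 : ℕ → Submodule K A) [GradedAlgebra 𝒜]
    (hA : GradedIG.IsGradedIG 1 𝒜) :
    ((∀ f : GradedIG.LeftHom 𝒜, f = 0) → GradedIG.g 𝒜 ≤ 0) ∧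
    (GradedIG.HasFiniteGlobalDimension (𝒜 0) →
      (∀ f : GradedIG.RightHom 𝒜, f = 0) → GradedIG.g 𝒜 ≤ 0) := by
  refine ⟨fun hl => ?_, fun _ hr => ?_⟩
  · refine GradedIG.NoNegativeSocle.gInvariant_le_zero _ ?_ hA.1
    exact GradedIG.noNegativeSocle_of_cocycles_vanish _ hA.1 fun d hd G hG ψ hψ =>
      hG.apply_eq_zero hd (GradedIG.rightHomVanishes_op 𝒜 hl) hψ
  · have hleft : GradedIG.NoNegativeSocle 𝒜 :=
      GradedIG.noNegativeSocle_of_cocycles_vanish _ hA.2 fun d hd G hG ψ hψ =>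
        hG.apply_eq_zero hd (GradedIG.rightHomVanishes 𝒜 hr) hψ
    refine GradedIG.NoNegativeSocle.gInvariant_le_zero _ ?_ hA.1
    refine GradedIG.noNegativeSocle_of_cocycles_vanish _ hA.1 fun d hd G hG ψ _ => ?_
    rw [hleft.cocycle_op_eq_zero hd hG, LinearMap.zero_apply]
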